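/- Let $k$ be a field, let $G$ be a finite abelian group that splits over $k$ (the group algebra $kG$ is isomorphic, as a $k$-algebra, to a finite product of copies of $k$), and let $\mathcal C$ be an idempotent complete $k$-linear additive category with a $k$-linear $G$-action: $k$-linear autoequivalences $F_g\colon\mathcal C\to\mathcal C$ and natural isomorphisms $\varepsilon_{g,h}\colon F_gF_h\to F_{gh}$ ($g,h\in G$) with $\varepsilon_{gh,l}\circ\varepsilon_{g,h}F_l=\varepsilon_{g,hl}\circ F_g\varepsilon_{h,l}$ for all $g,h,l\in G$. A $G$-equivariant object is a pair $(X,\alpha)$ of an object $X$ of $\mathcal C$ and isomorphisms $\alpha_g\colon X\to F_g(X)$, $g\in G$, with $\alpha_{gh}=(\varepsilon_{g,h})_X\circ F_g(\alpha_h)\circ\alpha_g$; a morphism $(X,\alpha)\to(Y,\beta)$ is a morphism $f\colon X\to Y$ with $\beta_g\circ f=F_g(f)\circ\alpha_g$ for all $g$. These form a $k$-linear category $\mathcal C^G$. The character group $\widehat G=\mathrm{Hom}(G,k^*)$ acts strictly on $\mathcal C^G$ (the dual action): $\chi\in\widehat G$ acts by the automorphism $F_\chi$ with $F_\chi(X,\alpha)=(X,\chi\otimes\alpha)$,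 $(\chi\otimes\alpha)_g=\chi(g^{-1})\alpha_g$, and $F_\chi(f)=f$ on morphisms; all structure isomorphisms $F_\chi F_\psi=F_{\chi\psi}$ are identities. For a $k$-linear action of a group $H$ on a $k$-linear category $\mathcal D$, given by functors $F_h$ and isomorphisms $\varepsilon_{h,h'}$, an $H$-equivariant autoequivalence of $\mathcal D$ is a pair $(F,\delta)$ of a $k$-linear autoequivalence $F$ of $\mathcal D$ and natural isomorphisms $\delta_h\colon FF_h\to F_hF$, $h\in H$, with $\delta_{hh'}\circ F\varepsilon_{h,h'}=\varepsilon_{h,h'}F\circ F_h\delta_{h'}\circ\delta_hF_{h'}$. It is strictly equivariant if $FF_h=F_hF$ and $\delta_h$ is the identity for every $h$. Two such pairs $(F,\delta)$ and $(F',\delta')$ are isomorphic if there is a natural isomorphism $\phi\colon F\to F'$ with $F_h\phi\circ\delta_h=\delta'_h\circ\phi F_h$ for all $h$. The isomorphism classes $[F,\delta]$ form a group $\mathrm{Aut}(\mathcal D;H)$ under the multiplication induced by the composition $(E,\partial)(F,\delta)=(EF,(\partial_hF\circ E\delta_h)_{h\in H})$. A $G$-equivariant autoequivalence $(F,\delta)$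 of $\mathcal C$ induces the autoequivalence $(F,\delta)^G$ of $\mathcal C^G$ that sends $(X,\alpha)$ to $(F(X),((\delta_g)_X\circ F(\alpha_g))_{g\in G})$ and acts on morphisms by $F$; together with identity isomorphisms it is a strictly $\widehat G$-equivariant autoequivalence with respect to the dual action. This defines the equivariantization homomorphism $$(-)^G\colon \mathrm{Aut}(\mathcal C;G)\longrightarrow\mathrm{Aut}(\mathcal C^G;\widehat G),\qquad [F,\delta]\mapsto[(F,\delta)^G].$$ **Theorem.** The homomorphism $(-)^G$ is an isomorphism of groups. In particular, every $\widehat G$-equivariant autoequivalence of $\mathcal C^G$ is isomorphic to a strictly $\widehat G$-equivariant autoequivalence. -/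

import Mathlib

open CategoryTheory CategoryTheory.Limits

universe w' w v u

namespace Equivariantization

/-- A `k`-linear action of a group `G` on a `k`-linear category `C`: `k`-linear autoequivalences
`F g` with natural isomorphisms `ε g h : F_g F_h ≅ F_{gh}` satisfying the 2-cocycle condition.
In diagrammatic order the composite functor `F_g F_h` is `F h ⋙ F g`. The `eqToHom` only
identifies `F_{g(hl)}` with `F_{(gh)l}`. -/
structure LinearAction (k : Type w') [Field k] (G : Type w) [Group G]
    (C : Type u) [Category.{v} C] [Preadditive C] [CategoryTheory.Linear k C] where
  F : G → C ⥤ C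
  isEquivalence : ∀ g, (F g).IsEquivalence
  additive : ∀ g, (F g).Additive
  linear : ∀ g, (F g).Linear k
  ε : ∀ g h, F h ⋙ F g ≅ F (g * h)
  cocycle : ∀ (g h l : G) (X : C),
    (ε g h).hom.app ((F l).obj X) ≫ (ε (g * h) l).hom.app X =
      (F g).map ((ε h l).hom.app X) ≫ (ε g (h * l)).hom.app X ≫
        eqToHom (by rw [mul_assoc])

attribute [instance] LinearAction.isEquivalence LinearAction.additive LinearAction.linear

section

variable {k : Type w'} [Field k] {G : Type w} [Group G]
  {C : Type u} [Category.{v} C] [Preadditive C] [CategoryTheory.Linear k C]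

/-! ### The category of equivariant objects -/

/-- A `G`-equivariant object `(X, α)`: isomorphisms `α g : X ≅ F_g X` with
`α_{gh} = (ε_{g,h})_X ∘ F_g(α_h) ∘ α_g`. -/
structure EquivObj (A : LinearAction k G C) where
  X : C
  α : ∀ g, X ≅ (A.F g).obj X
  rel : ∀ g h, (α (g * h)).hom = (α g).hom ≫ (A.F g).map (α h).hom ≫ (A.ε g h).hom.app X

namespace EquivObj

variable {A : LinearAction k G C}

/-- A morphism `(X, α) ⟶ (Y, β)`: a morphism `f : X ⟶ Y` with `β_g ∘ f = F_g(f) ∘ α_g`. -/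
@[ext]
structure Hom (P Q : EquivObj A) where
  f : P.X ⟶ Q.X
  comm : ∀ g, f ≫ (Q.α g).hom = (P.α g).hom ≫ (A.F g).map f

instance : Category.{v} (EquivObj A) where
  Hom P Q := Hom P Q
  id P := ⟨𝟙 P.X, by simp⟩
  comp a b := ⟨a.f ≫ b.f, fun g => by
    rw [Category.assoc, b.comm, ← Category.assoc, a.comm, Category.assoc, Functor.map_comp]⟩

@[ext]
theorem hom_ext {P Q : EquivObj A} {a b : P ⟶ Q} (h : a.f = b.f) : a = b := Hom.ext h

@[simp] theorem id_f (P : EquivObj A) : Hom.f (𝟙 P) = 𝟙 P.X := rfl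

@[simp] theorem comp_f {P Q R : EquivObj A} (a : P ⟶ Q) (b : Q ⟶ R) :
    (a ≫ b).f = a.f ≫ b.f := rfl

/-- An isomorphism in `C` that is a morphism of equivariant objects is an isomorphism there. -/
@[simps]
def isoMk {P Q : EquivObj A} (i : P.X ≅ Q.X)
    (h : ∀ g, i.hom ≫ (Q.α g).hom = (P.α g).hom ≫ (A.F g).map i.hom) : P ≅ Q where
  hom := ⟨i.hom, h⟩
  inv := ⟨i.inv, fun g => by
    rw [Iso.inv_comp_eq, ← Category.assoc, h, Category.assoc, ← Functor.map_comp]; simp⟩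

section Linear

variable (P Q : EquivObj A)

instance : Zero (P ⟶ Q) := ⟨⟨0, by simp⟩⟩
instance : Add (P ⟶ Q) := ⟨fun a b => ⟨a.f + b.f, by simp [a.comm, b.comm]⟩⟩
instance : Neg (P ⟶ Q) := ⟨fun a => ⟨-a.f, by simp [a.comm]⟩⟩
instance : Sub (P ⟶ Q) := ⟨fun a b => ⟨a.f - b.f, by simp [a.comm, b.comm]⟩⟩
instance : SMul ℕ (P ⟶ Q) := ⟨fun n a => ⟨n • a.f, by simp [a.comm]⟩⟩
instance : SMul ℤ (P ⟶ Q) := ⟨fun n a => ⟨n • a.f, by simp [a.comm]⟩⟩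
instance : SMul k (P ⟶ Q) := ⟨fun c a => ⟨c • a.f, by simp [a.comm]⟩⟩

theorem f_injective : Function.Injective (fun a : P ⟶ Q => a.f) := fun _ _ h => hom_ext h

instance : AddCommGroup (P ⟶ Q) :=
  (f_injective P Q).addCommGroup _ rfl (fun _ _ => rfl) (fun _ => rfl) (fun _ _ => rfl)
    (fun _ _ => rfl) (fun _ _ => rfl)

variable {P Q}

@[simp] theorem add_f (a b : P ⟶ Q) : (a + b).f = a.f + b.f := rfl

@[simp] theorem smul_f (c : k) (a : P ⟶ Q) : (c • a).f = c • a.f := rfl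

variable (P Q)

/-- Forgetting the equivariant structure, as an additive map on morphisms. -/
def fHom : (P ⟶ Q) →+ (P.X ⟶ Q.X) where
  toFun a := a.f
  map_zero' := rfl
  map_add' _ _ := rfl

instance : Module k (P ⟶ Q) :=
  (f_injective P Q).module k (fHom P Q) (fun _ _ => rfl)

end Linear

instance : Preadditive (EquivObj A) where
  add_comp _ _ _ _ _ _ := by ext; simp
  comp_add _ _ _ _ _ _ := by ext; simp

instance : CategoryTheory.Linear k (EquivObj A) where
  smul_comp _ _ _ _ _ _ := by ext; simp
  comp_smul _ _ _ _ _ _ := by ext; simp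

end EquivObj

/-! ### The dual action of the character group -/

variable (A : LinearAction k G C)

/-- `F_χ (X, α) = (X, χ ⊗ α)` with `(χ ⊗ α)_g = χ(g⁻¹) α_g`. -/
abbrev twistObj (χ : G →* kˣ) (P : EquivObj A) : EquivObj A where
  X := P.X
  α g :=
    { hom := ((χ g⁻¹ : kˣ) : k) • (P.α g).hom
      inv := ((χ g : kˣ) : k) • (P.α g).inv
      hom_inv_id := by simp [smul_smul]
      inv_hom_id := by simp [smul_smul] }
  rel g h := by
    simp only [P.rel, mul_inv_rev, map_mul, Units.val_mul, Functor.map_smul,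
      CategoryTheory.Linear.smul_comp, CategoryTheory.Linear.comp_smul, smul_smul]

@[simp]
theorem twistObj_α_hom (χ : G →* kˣ) (P : EquivObj A) (g : G) :
    ((twistObj A χ P).α g).hom = ((χ g⁻¹ : kˣ) : k) • (P.α g).hom := rfl

/-- The automorphism `F_χ` of `C^G`; it is the identity on morphisms. -/
abbrev twist (χ : G →* kˣ) : EquivObj A ⥤ EquivObj A where
  obj P := twistObj A χ P
  map {P Q} a := ⟨a.f, fun g => by
    simp only [ CategoryTheory.Linear.comp_smul,
      CategoryTheory.Linear.smul_comp, a.comm]⟩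

/-- `F_χ F_ψ = F_{χψ}` on objects; the underlying morphism in `C` is the identity. -/
def twistCompIso (χ ψ : G →* kˣ) (P : EquivObj A) :
    (twist A χ).obj ((twist A ψ).obj P) ≅ (twist A (χ * ψ)).obj P :=
  EquivObj.isoMk (Iso.refl P.X) fun g => by simp [smul_smul]

instance (χ : G →* kˣ) : (twist A χ).Faithful where
  map_injective h := EquivObj.hom_ext (congrArg EquivObj.Hom.f h :)

theorem EquivObj.ext_α {A : LinearAction k G C} {X : C} {α β : ∀ g, X ≅ (A.F g).obj X} {h h'}
    (e : ∀ g, (α g).hom = (β g).hom) : EquivObj.mk (A := A) X α h = ⟨X, β, h'⟩ := by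
  obtain rfl : α = β := funext fun g => Iso.ext (e g)
  rfl

theorem twist_obj_one (P : EquivObj A) : (twist A 1).obj P = P :=
  EquivObj.ext_α fun g => by simp

theorem twist_obj_mul (χ ψ : G →* kˣ) (P : EquivObj A) :
    (twist A χ).obj ((twist A ψ).obj P) = (twist A (χ * ψ)).obj P :=
  EquivObj.ext_α fun g => by simp [smul_smul]

instance (χ : G →* kˣ) : (twist A χ).Full where
  map_surjective {P Q} b := by
    refine ⟨⟨b.f, fun g => ?_⟩, rfl⟩
    have h := b.comm g
    simp only [ CategoryTheory.Linear.comp_smul,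
      CategoryTheory.Linear.smul_comp] at h
    have h2 := congrArg (fun z => ((χ g : kˣ) : k) • z) h
    simpa [smul_smul] using h2

instance (χ : G →* kˣ) : (twist A χ).EssSurj where
  mem_essImage P := ⟨(twist A χ⁻¹).obj P, ⟨eqToIso ((twist_obj_mul A χ χ⁻¹ P).trans
    ((congrArg (fun θ => (twist A θ).obj P) (mul_inv_cancel χ)).trans (twist_obj_one A P)))⟩⟩

theorem eqToHom_f {P Q : EquivObj A} (h : P = Q) :
    EquivObj.Hom.f (eqToHom h) = eqToHom (congrArg EquivObj.X h) := by
  subst h; rfl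

/-- The dual action of the character group `Ĝ = Hom(G, kˣ)` on `C^G`. It is strict: its structure
isomorphisms are identities. -/
abbrev dualAction : LinearAction k (G →* kˣ) (EquivObj A) where
  F := twist A
  isEquivalence χ := {}
  additive χ := { map_add := rfl }
  linear χ := { map_smul := fun _ _ => rfl }
  ε χ ψ := NatIso.ofComponents (twistCompIso A χ ψ) fun {P Q} a => by
    ext
    change a.f ≫ 𝟙 Q.X = 𝟙 P.X ≫ a.f
    simp
  cocycle χ ψ θ P := by
    ext
    simp only [EquivObj.comp_f, eqToHom_f]
    change 𝟙 P.X ≫ 𝟙 P.X = 𝟙 P.X ≫ 𝟙 P.X ≫ 𝟙 P.X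
    simp

/-- The dual action is strict. -/
theorem dualAction_strict (χ ψ : G →* kˣ) :
    ∃ h : (dualAction A).F ψ ⋙ (dualAction A).F χ = (dualAction A).F (χ * ψ),
      (dualAction A).ε χ ψ = eqToIso h := by
  refine ⟨CategoryTheory.Functor.ext (twist_obj_mul A χ ψ) fun P Q a => ?_, ?_⟩
  · ext
    simp only [EquivObj.comp_f, eqToHom_f]
    change a.f = 𝟙 P.X ≫ a.f ≫ 𝟙 Q.X
    simp
  · ext P
    rw [eqToIso.hom, eqToHom_app, eqToHom_f]
    rfl

/-! ### Equivariant autoequivalences -/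

/-- A `k`-linear `G`-equivariant autoequivalence `(F, δ)`, with `δ g : F F_g ≅ F_g F` and
`δ_{gh} ∘ F ε_{g,h} = ε_{g,h} F ∘ F_g δ_h ∘ δ_g F_h`. -/
structure EquivAut where
  F : C ⥤ C
  isEquivalence : F.IsEquivalence
  additive : F.Additive
  linear : F.Linear k
  δ : ∀ g, A.F g ⋙ F ≅ F ⋙ A.F g
  compat : ∀ (g h : G) (X : C),
    F.map ((A.ε g h).hom.app X) ≫ (δ (g * h)).hom.app X =
      (δ g).hom.app ((A.F h).obj X) ≫ (A.F g).map ((δ h).hom.app X) ≫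
        (A.ε g h).hom.app (F.obj X)

attribute [instance] EquivAut.isEquivalence EquivAut.additive EquivAut.linear

namespace EquivAut

variable {A}

/-- `(F, δ)` is strictly equivariant: `F F_g = F_g F` and `δ_g` is the identity, for each `g`. -/
def IsStrict (E : EquivAut A) : Prop :=
  ∀ g, ∃ h : A.F g ⋙ E.F = E.F ⋙ A.F g, E.δ g = eqToIso h

/-- `(F, δ)` and `(F', δ')` are isomorphic: there is a natural isomorphism `φ : F ≅ F'` with
`F_g φ ∘ δ_g = δ'_g ∘ φ F_g`. -/
def Isomorphic (E E' : EquivAut A) : Prop :=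
  ∃ φ : E.F ≅ E'.F, ∀ (g : G) (X : C),
    (E.δ g).hom.app X ≫ (A.F g).map (φ.hom.app X) =
      φ.hom.app ((A.F g).obj X) ≫ (E'.δ g).hom.app X

theorem Isomorphic.refl (E : EquivAut A) : Isomorphic E E :=
  ⟨Iso.refl _, by simp⟩

theorem Isomorphic.symm {E E' : EquivAut A} : Isomorphic E E' → Isomorphic E' E := by
  rintro ⟨φ, h⟩
  refine ⟨φ.symm, fun g X => ?_⟩
  have := h g X
  rw [← cancel_epi (φ.hom.app ((A.F g).obj X)),
    ← cancel_mono ((A.F g).map (φ.hom.app X))]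
  simp only [Category.assoc, Iso.symm_hom, Iso.hom_inv_id_app_assoc]
  rw [← Functor.map_comp, Iso.inv_hom_id_app, this]
  simp

theorem Isomorphic.trans {E E' E'' : EquivAut A} :
    Isomorphic E E' → Isomorphic E' E'' → Isomorphic E E'' := by
  rintro ⟨φ, h⟩ ⟨ψ, h'⟩
  refine ⟨φ ≪≫ ψ, fun g X => ?_⟩
  have e1 := h g X
  have e2 := h' g X
  simp only [Iso.trans_hom, NatTrans.comp_app, Functor.map_comp, Category.assoc]
  rw [reassoc_of% e1, e2]

variable (A) in
/-- Isomorphism of equivariant autoequivalences as an equivalence relation. -/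
def setoid : Setoid (EquivAut A) where
  r := Isomorphic
  iseqv := ⟨Isomorphic.refl, Isomorphic.symm, Isomorphic.trans⟩

variable (A) in
/-- The identity equivariant autoequivalence. -/
abbrev id : EquivAut A where
  F := 𝟭 C
  isEquivalence := inferInstance
  additive := inferInstance
  linear := inferInstance
  δ g := Functor.rightUnitor _ ≪≫ (Functor.leftUnitor _).symm
  compat g h X := by simp

/-- The composite `(E, ∂)(F, δ) = (EF, ∂F ∘ Eδ)`. -/
abbrev comp (E E' : EquivAut A) : EquivAut A where
  F := E'.F ⋙ E.F
  isEquivalence := inferInstance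
  additive := inferInstance
  linear := inferInstance
  δ g := NatIso.ofComponents
    (fun X => E.F.mapIso ((E'.δ g).app X) ≪≫ (E.δ g).app (E'.F.obj X))
    (fun {X Y} f => by
      have e1 := (E'.δ g).hom.naturality f
      have e2 := (E.δ g).hom.naturality (E'.F.map f)
      dsimp at e1 e2 ⊢
      rw [← Category.assoc, ← Functor.map_comp, e1, Functor.map_comp, Category.assoc, e2,
        Category.assoc])
  compat g h X := by
    have e1 := E'.compat g h X
    have e2 := E.compat g h (E'.F.obj X)
    have e3 := (E.δ g).hom.naturality ((E'.δ h).hom.app X)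
    dsimp at e1 e2 e3 ⊢
    rw [← Category.assoc, ← Functor.map_comp, e1]
    simp only [Functor.map_comp, Category.assoc]
    rw [e2, reassoc_of% e3]

/-- Preservation of isomorphism under composition. -/
theorem comp_congr {E₁ E₂ E₁' E₂' : EquivAut A} (h : Isomorphic E₁ E₂)
    (h' : Isomorphic E₁' E₂') : Isomorphic (E₁.comp E₁') (E₂.comp E₂') := by
  obtain ⟨φ, h⟩ := h
  obtain ⟨ψ, h'⟩ := h'
  refine ⟨Functor.isoWhiskerRight ψ E₁.F ≪≫ Functor.isoWhiskerLeft E₂'.F φ, fun g X => ?_⟩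
  have e1 := h' g X
  have e2 := h g (E₂'.F.obj X)
  have e3 := (E₁.δ g).hom.naturality (ψ.hom.app X)
  have e4 := φ.hom.naturality ((E₂'.δ g).hom.app X)
  simp only [comp] at *
  dsimp at e1 e2 e3 e4 ⊢
  simp only [Functor.map_comp, Category.assoc] at *
  rw [← reassoc_of% e3, e2, ← Category.assoc, ← Functor.map_comp, e1, Functor.map_comp,
    Category.assoc, reassoc_of% e4]

/-- Every equivariant autoequivalence has a quasi-inverse. -/
theorem exists_inv (E : EquivAut A) : ∃ E' : EquivAut A, Isomorphic (E'.comp E) (id A) := by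
  let e := E.F.asEquivalence
  have hadd : e.functor.Additive := E.additive
  have hlin : e.functor.Linear k := E.linear
  let c : ∀ X, E.F.obj (E.F.inv.obj X) ≅ X := fun X => e.counitIso.app X
  have cnat : ∀ {X Y : C} (f : X ⟶ Y),
      E.F.map (E.F.inv.map f) ≫ (c Y).hom = (c X).hom ≫ f :=
    fun f => e.counitIso.hom.naturality f
  let d : ∀ g X, E.F.inv.obj ((A.F g).obj X) ≅ (A.F g).obj (E.F.inv.obj X) := fun g X =>
    E.F.preimageIso (c _ ≪≫ (A.F g).mapIso (c X).symm ≪≫ ((E.δ g).app _).symm)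
  -- the defining property of the components `d`
  have hd : ∀ g X, E.F.map (d g X).hom ≫ (E.δ g).hom.app (E.F.inv.obj X) ≫
      (A.F g).map (c X).hom = (c _).hom := fun g X => by
    simp only [d, Functor.preimageIso_hom, Functor.map_preimage, Iso.trans_hom, Category.assoc,
      Functor.mapIso_hom, Iso.symm_hom, Iso.app_inv]
    rw [Iso.inv_hom_id_app_assoc, ← Functor.map_comp, Iso.inv_hom_id]
    simp
  -- a morphism is determined by its image composed with the isomorphism below
  have hinj : ∀ (g : G) {Z X : C} (a b : Z ⟶ (A.F g).obj (E.F.inv.obj X)),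
      E.F.map a ≫ (E.δ g).hom.app (E.F.inv.obj X) ≫ (A.F g).map (c X).hom =
      E.F.map b ≫ (E.δ g).hom.app (E.F.inv.obj X) ≫ (A.F g).map (c X).hom → a = b := by
    intro g Z X a b h
    exact E.F.map_injective ((cancel_mono _).1 h)
  have hnat : ∀ g {X Y : C} (f : X ⟶ Y), E.F.inv.map ((A.F g).map f) ≫ (d g Y).hom =
      (d g X).hom ≫ (A.F g).map (E.F.inv.map f) := by
    intro g X Y f
    apply hinj
    have n1 := (E.δ g).hom.naturality (E.F.inv.map f)
    dsimp at n1
    simp only [Functor.map_comp, Category.assoc]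
    rw [hd, cnat, reassoc_of% n1, ← (A.F g).map_comp, cnat, (A.F g).map_comp,
      reassoc_of% (hd g X)]
  refine ⟨{ F := E.F.inv
            isEquivalence := inferInstance
            additive := inferInstanceAs e.inverse.Additive
            linear := inferInstanceAs (e.inverse.Linear k)
            δ := fun g => NatIso.ofComponents (d g) (fun f => hnat g f)
            compat := ?_ }, ?_⟩
  · intro g h X
    apply hinj
    have n1 := (A.ε g h).hom.naturality (c X).hom
    have n2 := E.compat g h (E.F.inv.obj X)
    have n3 := (E.δ g).hom.naturality (d h X).hom
    dsimp at n1 n2 n3 ⊢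
    simp only [Functor.map_comp, Category.assoc]
    rw [hd, cnat, reassoc_of% n2, reassoc_of% n3, ← n1]
    rw [← reassoc_of% (hd g ((A.F h).obj X)), ← hd h X]
    simp only [Functor.map_comp, Category.assoc]
  · obtain ⟨t, ht⟩ : ∃ t : E.F ⋙ E.F.inv ≅ 𝟭 C, ∀ X, (c (E.F.obj X)).hom =
        E.F.map (t.hom.app X) := ⟨e.unitIso.symm, fun X => e.counit_app_functor X⟩
    refine ⟨t, fun g X => ?_⟩
    have h1 := hd g (E.F.obj X)
    have n1 := (E.δ g).hom.naturality (t.hom.app X)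
    have n3 := cnat ((E.δ g).hom.app X)
    apply E.F.map_injective
    rw [← cancel_mono ((E.δ g).hom.app X)]
    rw [ht] at h1
    have n4 := ht ((A.F g).obj X)
    dsimp at n1 n3 n4 h1 ⊢
    simp only [Functor.map_comp, Category.assoc, Category.comp_id]
    rw [n1, h1, n3, n4]

variable (A) in
/-- The group `Aut(C; G)` of isomorphism classes `[F, δ]` of `k`-linear `G`-equivariant
autoequivalences. -/
def AutGroup : Type _ := Quotient (setoid A)

/-- The isomorphism class `[F, δ]`. -/
def cls (E : EquivAut A) : AutGroup A := Quotient.mk (setoid A) E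

theorem cls_eq_iff {E E' : EquivAut A} : cls E = cls E' ↔ Isomorphic E E' := Quotient.eq

/-- Multiplication is induced by composition: `[E][E'] = [EE']`. -/
instance : Mul (AutGroup A) :=
  ⟨Quotient.map₂ comp fun _ _ h _ _ h' => comp_congr h h'⟩

theorem cls_mul (E E' : EquivAut A) : cls E * cls E' = cls (E.comp E') := rfl

instance : One (AutGroup A) := ⟨cls (id A)⟩

theorem exists_cls_inv (x : AutGroup A) : ∃ y : AutGroup A, y * x = 1 := by
  obtain ⟨E, rfl⟩ := Quotient.exists_rep x
  obtain ⟨E', h⟩ := exists_inv E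
  exact ⟨cls E', cls_eq_iff.2 h⟩

noncomputable instance : Inv (AutGroup A) := ⟨fun x => (exists_cls_inv x).choose⟩

noncomputable instance : Group (AutGroup A) :=
  Group.ofLeftAxioms
    (by
      rintro ⟨E₁⟩ ⟨E₂⟩ ⟨E₃⟩
      exact cls_eq_iff.2 ⟨Iso.refl _, fun g X => by simp⟩)
    (by
      rintro ⟨E⟩
      exact cls_eq_iff.2 ⟨Iso.refl _, fun g X => by simp⟩)
    (fun x => (exists_cls_inv x).choose_spec)

/-! ### Equivariantization -/

/-- The object part of `(F, δ)^G`: it sends `(X, α)` to `(F X, α̃)` with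
`α̃_g = (δ_g)_X ∘ F(α_g)`. -/
abbrev liftObj (E : EquivAut A) (P : EquivObj A) : EquivObj A where
  X := E.F.obj P.X
  α g := E.F.mapIso (P.α g) ≪≫ (E.δ g).app P.X
  rel g h := by
    have n1 := (E.δ g).hom.naturality (P.α h).hom
    have n2 := E.compat g h P.X
    dsimp at n1 n2 ⊢
    simp only [P.rel, Functor.map_comp, Category.assoc]
    rw [n2, reassoc_of% n1]

/-- The functor `(F, δ)^G : C^G ⥤ C^G`, acting on morphisms by `F`. -/
abbrev lift (E : EquivAut A) : EquivObj A ⥤ EquivObj A where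
  obj P := E.liftObj P
  map {P Q} a := ⟨E.F.map a.f, fun g => by
    have n1 := (E.δ g).hom.naturality a.f
    dsimp at n1 ⊢
    rw [← Category.assoc, ← Functor.map_comp, a.comm, Functor.map_comp, Category.assoc, n1,
      Category.assoc]⟩
  map_id _ := by ext; simp
  map_comp _ _ := by ext; simp

instance (E : EquivAut A) : E.lift.Faithful where
  map_injective h := EquivObj.hom_ext (E.F.map_injective (congrArg EquivObj.Hom.f h :))

instance (E : EquivAut A) : E.lift.Full where
  map_surjective {P Q} b := by
    obtain ⟨a, ha⟩ := E.F.map_surjective b.f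
    refine ⟨⟨a, fun g => ?_⟩, EquivObj.hom_ext ha⟩
    apply E.F.map_injective
    have h := b.comm g
    have n1 := (E.δ g).hom.naturality a
    dsimp at h n1
    rw [← ha, Category.assoc, ← n1, ← Category.assoc, ← Category.assoc, cancel_mono] at h
    simpa using h

instance (E : EquivAut A) : E.lift.EssSurj where
  mem_essImage Q := by
    let X := E.F.objPreimage Q.X
    let t : E.F.obj X ≅ Q.X := E.F.objObjPreimageIso Q.X
    let a : ∀ g, X ≅ (A.F g).obj X := fun g =>
      E.F.preimageIso (t ≪≫ Q.α g ≪≫ (A.F g).mapIso t.symm ≪≫ ((E.δ g).app X).symm)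
    have ha : ∀ g, E.F.map (a g).hom ≫ (E.δ g).hom.app X ≫ (A.F g).map t.hom =
        t.hom ≫ (Q.α g).hom := fun g => by
      simp only [a, Functor.preimageIso_hom, Functor.map_preimage, Iso.trans_hom, Category.assoc,
        Functor.mapIso_hom, Iso.symm_hom, Iso.app_inv]
      rw [Iso.inv_hom_id_app_assoc, ← Functor.map_comp, Iso.inv_hom_id]
      simp
    refine ⟨⟨X, a, fun g h => ?_⟩, ⟨EquivObj.isoMk t fun g => ?_⟩⟩
    · apply E.F.map_injective
      rw [← cancel_mono ((E.δ (g * h)).hom.app X ≫ (A.F (g * h)).map t.hom)]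
      have n1 := (A.ε g h).hom.naturality t.hom
      have n2 := E.compat g h X
      have n3 := (E.δ g).hom.naturality (a h).hom
      dsimp at n1 n2 n3 ⊢
      rw [ha, Q.rel]
      simp only [Functor.map_comp, Category.assoc]
      rw [reassoc_of% n2, reassoc_of% n3, ← n1, ← reassoc_of% (ha g)]
      simp only [← Functor.map_comp_assoc, ha h]
    · have h := ha g
      dsimp at h ⊢
      rw [Category.assoc, h]

/-- `F_χ (F, δ)^G = (F, δ)^G F_χ` on objects. -/
theorem lift_twist_obj (E : EquivAut A) (χ : G →* kˣ) (P : EquivObj A) :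
    E.lift.obj ((twist A χ).obj P) = (twist A χ).obj (E.lift.obj P) :=
  EquivObj.ext_α fun g => by simp

/-- `F_χ (F, δ)^G = (F, δ)^G F_χ` as functors. -/
theorem lift_twist (E : EquivAut A) (χ : G →* kˣ) :
    twist A χ ⋙ E.lift = E.lift ⋙ twist A χ :=
  CategoryTheory.Functor.ext (E.lift_twist_obj χ) fun P Q a => by
    ext
    simp only [EquivObj.comp_f, eqToHom_f]
    change E.F.map a.f = 𝟙 _ ≫ E.F.map a.f ≫ 𝟙 _
    simp

/-- The equivariantization of `(F, δ)`: the functor `(F, δ)^G` with identity structure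
isomorphisms, a strictly `Ĝ`-equivariant autoequivalence of `C^G`. -/
abbrev equivariantization (E : EquivAut A) : EquivAut (dualAction A) where
  F := E.lift
  isEquivalence := {}
  additive := { map_add := EquivObj.hom_ext E.F.map_add }
  linear := { map_smul := fun f r => EquivObj.hom_ext (E.F.map_smul r f.f) }
  δ χ := eqToIso (E.lift_twist χ)
  compat χ ψ P := by
    ext
    simp only [EquivObj.comp_f, eqToIso.hom, eqToHom_app, eqToHom_f]
    change E.F.map (𝟙 P.X) ≫ 𝟙 _ = 𝟙 _ ≫ 𝟙 _ ≫ 𝟙 _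
    simp

theorem equivariantization_δ_f (E : EquivAut A) (χ : G →* kˣ) (P : EquivObj A) :
    ((E.equivariantization.δ χ).hom.app P).f = 𝟙 (E.F.obj P.X) := by
  rw [eqToIso.hom, eqToHom_app, eqToHom_f]; rfl

theorem equivariantization_congr {E E' : EquivAut A} (h : Isomorphic E E') :
    Isomorphic E.equivariantization E'.equivariantization := by
  obtain ⟨φ, h⟩ := h
  refine ⟨NatIso.ofComponents (fun P => EquivObj.isoMk (φ.app P.X) fun g => ?_) ?_, ?_⟩
  · have e1 := h g P.X
    have e2 := φ.hom.naturality (P.α g).hom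
    dsimp at e1 e2 ⊢
    rw [Category.assoc, e1, reassoc_of% e2]
  · intro P Q a
    ext
    exact φ.hom.naturality a.f
  · intro χ P
    ext
    rw [EquivObj.comp_f, EquivObj.comp_f, equivariantization_δ_f, equivariantization_δ_f]
    change 𝟙 _ ≫ φ.hom.app P.X = φ.hom.app P.X ≫ 𝟙 _
    simp

theorem equivariantization_comp (E E' : EquivAut A) :
    Isomorphic (E.comp E').equivariantization
      (E.equivariantization.comp E'.equivariantization) := by
  refine ⟨NatIso.ofComponents (fun P => EquivObj.isoMk (Iso.refl _) fun g => ?_) ?_, ?_⟩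
  · simp
  · intro P Q a
    ext
    simp
  · intro χ P
    ext
    rw [EquivObj.comp_f, EquivObj.comp_f, equivariantization_δ_f]
    have e : (((E.equivariantization.comp E'.equivariantization).δ χ).hom.app P).f =
        E.F.map ((E'.equivariantization.δ χ).hom.app P).f ≫
          ((E.equivariantization.δ χ).hom.app (E'.lift.obj P)).f := rfl
    rw [e, equivariantization_δ_f, equivariantization_δ_f]
    change 𝟙 _ ≫ 𝟙 _ = 𝟙 _ ≫ E.F.map (𝟙 _) ≫ 𝟙 _
    simp

variable (A) in
/-- The equivariantization homomorphism `Aut(C; G) → Aut(C^G; Ĝ)`, `[F, δ] ↦ [(F, δ)^G]`. -/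
noncomputable def equivariantizationHom : AutGroup A →* AutGroup (dualAction A) :=
  MonoidHom.mk' (Quotient.map equivariantization fun _ _ h => equivariantization_congr h)
    (by
      rintro ⟨E⟩ ⟨E'⟩
      exact cls_eq_iff.2 (equivariantization_comp E E'))

theorem equivariantizationHom_cls (E : EquivAut A) :
    equivariantizationHom A (cls E) = cls E.equivariantization := rfl

end EquivAut

end

/-- A finite group `G` splits over `k`: the group algebra `kG` is isomorphic, as a `k`-algebra,
to a finite product of copies of `k`. -/
def SplitsOver (k : Type w') [Field k] (G : Type w) [Group G] : Prop :=
  ∃ n : ℕ, Nonempty (MonoidAlgebra k G ≃ₐ[k] (Fin n → k))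

end Equivariantization

/-
Since `kG` is a product of copies of `k`, the characters of `G` separate its points, `|G|` is
invertible in `k`, and every representation of `G` over `k` is the sum of its weight spaces. Apply
this to the morphisms `X ⟶ Y` of `C` between objects carrying equivariant structures, on which `G`
acts by conjugation: the part of weight `χ⁻¹` consists of the morphisms `(X, α) ⟶ F_χ (Y, β)` of
`C^G`. Hence a `Ĝ`-equivariant autoequivalence of `C^G` acts on all morphisms of `C` between such
objects, compatibly with conjugation. Every object `X` of `C` is a summand of the equivariant object
`⨁ F_g X`, so `C` is the idempotent completion of the full subcategory of these objects, and
functors and natural transformations extend uniquely to it.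
-/

namespace Equivariantization

section Retracts

variable {B C D : Type*} [Category* B] [Category* C] [Category* D]

/-- A functor `J : B ⥤ C` is dense up to retracts if every object of `C` is a retract of an object
in its image. For `J` fully faithful and `C` idempotent complete this says that `C` is the
idempotent completion of `B`. -/
class IsRetractDense (J : B ⥤ C) : Prop where
  exists_retract (X : C) : ∃ b, Nonempty (Retract X (J.obj b))

open IsRetractDense (exists_retract)

variable (J : B ⥤ C)

instance faithful_whiskeringLeft_of_isRetractDense [IsRetractDense J] :
    ((Functor.whiskeringLeft B C D).obj J).Faithful where
  map_injective {F F' σ τ} h := by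
    ext X
    obtain ⟨b, ⟨r⟩⟩ := exists_retract (J := J) X
    rw [← cancel_mono (F'.map r.i), ← σ.naturality, ← τ.naturality]
    exact congrArg (F.map r.i ≫ ·) (congrArg (fun ρ => ρ.app b) h)

theorem natTrans_ext_of_isRetractDense [IsRetractDense J] {F F' : C ⥤ D} {σ τ : F ⟶ F'}
    (h : ∀ b, σ.app (J.obj b) = τ.app (J.obj b)) : σ = τ :=
  ((Functor.whiskeringLeft B C D).obj J).map_injective (NatTrans.ext (funext h))

instance full_whiskeringLeft_of_isRetractDense [IsRetractDense J] [J.Full] :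
    ((Functor.whiskeringLeft B C D).obj J).Full where
  map_surjective {F F'} τ := by
    choose p r using exists_retract (J := J)
    replace r := fun X => (r X).some
    have τ_naturality {b b' : B} (g : J.obj b ⟶ J.obj b') :
        F.map g ≫ τ.app b' = τ.app b ≫ F'.map g := by
      obtain ⟨g, rfl⟩ := J.map_surjective g
      exact τ.naturality g
    refine ⟨{ app := fun X => F.map (r X).i ≫ τ.app (p X) ≫ F'.map (r X).r
              naturality := fun X Y f => ?_ }, ?_⟩
    · have h := τ_naturality ((r X).r ≫ f ≫ (r Y).i)
      simp only [Functor.map_comp, Category.assoc] at h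
      calc F.map f ≫ F.map (r Y).i ≫ τ.app (p Y) ≫ F'.map (r Y).r
          = F.map (r X).i ≫ (F.map (r X).r ≫ F.map f ≫ F.map (r Y).i ≫ τ.app (p Y)) ≫
              F'.map (r Y).r := by
            simp only [Category.assoc]
            rw [← F.map_comp_assoc (r X).i, Retract.retract, F.map_id, Category.id_comp]
        _ = (F.map (r X).i ≫ τ.app (p X) ≫ F'.map (r X).r) ≫ F'.map f := by
          rw [h]
          simp [← Functor.map_comp]
    · ext b
      change F.map (r (J.obj b)).i ≫ τ.app _ ≫ F'.map (r (J.obj b)).r = τ.app b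
      rw [reassoc_of% (τ_naturality (r (J.obj b)).i), ← F'.map_comp, Retract.retract]
      exact (congrArg _ (F'.map_id _)).trans (Category.comp_id _)

theorem exists_natIso_of_isRetractDense [IsRetractDense J] [J.Full] {F F' : C ⥤ D}
    (η : J ⋙ F ≅ J ⋙ F') : ∃ t : F ≅ F', ∀ b, t.hom.app (J.obj b) = η.hom.app b :=
  ⟨((Functor.whiskeringLeft B C D).obj J).preimageIso η, fun b =>
    NatTrans.congr_app (((Functor.whiskeringLeft B C D).obj J).map_preimage η.hom) b⟩

instance essSurj_whiskeringLeft_of_isRetractDense [IsRetractDense J] [J.Full] [J.Faithful]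
    [IsIdempotentComplete D] : ((Functor.whiskeringLeft B C D).obj J).EssSurj where
  mem_essImage T := by
    choose p r using exists_retract (J := J)
    replace r := fun X => (r X).some
    let m {b b' : B} (f : J.obj b ⟶ J.obj b') : T.obj b ⟶ T.obj b' := T.map (J.preimage f)
    have m_comp {b b' b'' : B} (f : J.obj b ⟶ J.obj b') (g : J.obj b' ⟶ J.obj b'') :
        m f ≫ m g = m (f ≫ g) := by simp only [m, J.preimage_comp, T.map_comp]
    have m_id (b : B) : m (𝟙 (J.obj b)) = 𝟙 (T.obj b) := by simp only [m, J.preimage_id, T.map_id]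
    choose Y i e i_e e_i using fun X =>
      IsIdempotentComplete.idempotents_split _ (m ((r X).r ≫ (r X).i)) (by simp [m_comp])
    let F : C ⥤ D :=
      { obj := Y
        map := fun {X Z} f => i X ≫ m ((r X).r ≫ f ≫ (r Z).i) ≫ e Z
        map_id := fun X => by
          rw [Category.id_comp, ← e_i]
          simp [i_e]
        map_comp := fun f g => by
          simp only [Category.assoc]
          rw [reassoc_of% e_i, reassoc_of% m_comp, reassoc_of% m_comp]
          simp }
    refine ⟨F, ⟨NatIso.ofComponents (fun b =>
      { hom := i _ ≫ m (r (J.obj b)).r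
        inv := m (r (J.obj b)).i ≫ e _
        hom_inv_id := ?_
        inv_hom_id := ?_ }) fun {b b'} f => ?_⟩⟩
    · simp only [Category.assoc]
      rw [reassoc_of% m_comp, ← e_i]
      simp [i_e, F]
    · simp only [Category.assoc]
      rw [reassoc_of% e_i, m_comp, m_comp]
      simp [m_id]
    · have hf : T.map f = m (J.map f) := by simp only [m, J.preimage_map]
      simp only [Functor.whiskeringLeft_obj_obj, Functor.comp_map, Category.assoc, F, hf, m_comp]
      rw [reassoc_of% e_i, m_comp, m_comp]
      simp

theorem map_eq_of_retract (F : C ⥤ D) {X Y X' Y' : C} (r : Retract X X') (s : Retract Y Y')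
    (f : X ⟶ Y) : F.map f = F.map r.i ≫ F.map (r.r ≫ f ≫ s.i) ≫ F.map s.r := by
  simp [← Functor.map_comp]

variable (F : C ⥤ D)

theorem faithful_of_isRetractDense_comp [IsRetractDense J] [J.Full] [(J ⋙ F).Faithful] :
    F.Faithful where
  map_injective {X Y} f g hfg := by
    obtain ⟨b, ⟨r⟩⟩ := exists_retract (J := J) X
    obtain ⟨b', ⟨s⟩⟩ := exists_retract (J := J) Y
    obtain ⟨f', hf'⟩ := J.map_surjective (r.r ≫ f ≫ s.i)
    obtain ⟨g', hg'⟩ := J.map_surjective (r.r ≫ g ≫ s.i)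
    obtain rfl : f' = g' := (J ⋙ F).map_injective (by simp [hf', hg', hfg])
    simpa using congrArg (r.i ≫ · ≫ s.r) (hf'.symm.trans hg')

theorem full_of_isRetractDense_comp [IsRetractDense J] [(J ⋙ F).Full] : F.Full where
  map_surjective {X Y} a := by
    obtain ⟨b, ⟨r⟩⟩ := exists_retract (J := J) X
    obtain ⟨b', ⟨s⟩⟩ := exists_retract (J := J) Y
    obtain ⟨f, hf⟩ := (J ⋙ F).map_surjective (F.map r.r ≫ a ≫ F.map s.i)
    refine ⟨r.i ≫ J.map f ≫ s.r, ?_⟩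
    rw [F.map_comp, F.map_comp, ← Functor.comp_map, hf]
    simp only [Category.assoc]
    rw [← F.map_comp_assoc, ← F.map_comp]
    simp

theorem essSurj_of_retract [F.Full] [F.Faithful] [IsIdempotentComplete C]
    (h : ∀ Y, ∃ X, Nonempty (Retract Y (F.obj X))) : F.EssSurj where
  mem_essImage Y := by
    obtain ⟨X, ⟨r⟩⟩ := h Y
    obtain ⟨a, ha⟩ := F.map_surjective (r.r ≫ r.i)
    obtain ⟨Z, i, e, i_e, e_i⟩ := IsIdempotentComplete.idempotents_split X a
      (F.map_injective (by simp [ha]))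
    have map_e_i : F.map e ≫ F.map i = r.r ≫ r.i := by rw [← F.map_comp, e_i, ha]
    refine ⟨Z, ⟨⟨F.map i ≫ r.r, r.i ≫ F.map e, ?_, ?_⟩⟩⟩
    · simp only [Category.assoc]
      rw [← reassoc_of% map_e_i, ← F.map_comp, ← F.map_comp_assoc, i_e]
      simp
    · simp only [Category.assoc]
      rw [reassoc_of% map_e_i]
      simp

section Linear

variable [Preadditive B] [Preadditive C] [Preadditive D]

theorem additive_of_isRetractDense_comp [IsRetractDense J] [J.Full] [J.Additive]
    [(J ⋙ F).Additive] : F.Additive where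
  map_add {X Y f g} := by
    obtain ⟨b, ⟨r⟩⟩ := exists_retract (J := J) X
    obtain ⟨b', ⟨s⟩⟩ := exists_retract (J := J) Y
    obtain ⟨f', hf'⟩ := J.map_surjective (r.r ≫ f ≫ s.i)
    obtain ⟨g', hg'⟩ := J.map_surjective (r.r ≫ g ≫ s.i)
    have map_add' : F.map (J.map f' + J.map g') = F.map (J.map f') + F.map (J.map g') := by
      rw [← J.map_add]
      exact (J ⋙ F).map_add
    rw [map_eq_of_retract F r s (f + g), map_eq_of_retract F r s f, map_eq_of_retract F r s g,
      Preadditive.add_comp, Preadditive.comp_add, ← hf', ← hg', map_add', Preadditive.add_comp,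
      Preadditive.comp_add]

variable {k : Type*} [Semiring k] [CategoryTheory.Linear k B] [CategoryTheory.Linear k C]
  [CategoryTheory.Linear k D]

theorem linear_of_isRetractDense_comp [IsRetractDense J] [J.Full] [J.Additive] [J.Linear k]
    [F.Additive] [(J ⋙ F).Linear k] : F.Linear k where
  map_smul {X Y} f c := by
    obtain ⟨b, ⟨r⟩⟩ := exists_retract (J := J) X
    obtain ⟨b', ⟨s⟩⟩ := exists_retract (J := J) Y
    obtain ⟨f', hf'⟩ := J.map_surjective (r.r ≫ f ≫ s.i)
    have map_smul' : F.map (c • J.map f') = c • F.map (J.map f') := by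
      rw [← J.map_smul]
      exact (J ⋙ F).map_smul c f'
    rw [map_eq_of_retract F r s (c • f), map_eq_of_retract F r s f, Linear.smul_comp,
      Linear.comp_smul, ← hf', map_smul', Linear.smul_comp, Linear.comp_smul]

theorem exists_extension {B' : Type*} [Category* B'] [Preadditive B'] [CategoryTheory.Linear k B']
    [IsRetractDense J] [J.Full] [J.Faithful] [J.Additive] [J.Linear k] [IsIdempotentComplete C]
    (J' : B' ⥤ D) [IsRetractDense J'] [J'.Full] [J'.Faithful] [J'.Additive] [J'.Linear k]
    [IsIdempotentComplete D] (T : B ⥤ B') [T.IsEquivalence] [T.Additive] [T.Linear k] :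
    ∃ F : C ⥤ D, F.IsEquivalence ∧ F.Additive ∧ F.Linear k ∧ Nonempty (J ⋙ F ≅ T ⋙ J') := by
  let F := ((Functor.whiskeringLeft B C D).obj J).objPreimage (T ⋙ J')
  let θ : J ⋙ F ≅ T ⋙ J' := ((Functor.whiskeringLeft B C D).obj J).objObjPreimageIso (T ⋙ J')
  have : (J ⋙ F).Faithful := Functor.Faithful.of_iso θ.symm
  have : (J ⋙ F).Full := Functor.Full.of_iso θ.symm
  have : (J ⋙ F).Additive := Functor.additive_of_iso θ.symm
  have : (J ⋙ F).Linear k := Functor.linear_of_iso k θ.symm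
  have hfaithful : F.Faithful := faithful_of_isRetractDense_comp J F
  have hfull : F.Full := full_of_isRetractDense_comp J F
  have hadd : F.Additive := additive_of_isRetractDense_comp J F
  have hlin : F.Linear k := linear_of_isRetractDense_comp J F
  have hess : F.EssSurj := essSurj_of_retract F fun Y => by
    obtain ⟨b', ⟨r⟩⟩ := exists_retract (J := J') Y
    let b := T.objPreimage b'
    exact ⟨J.obj b, ⟨r.trans (.ofIso (J'.mapIso (T.objObjPreimageIso b').symm ≪≫ θ.symm.app b))⟩⟩
  exact ⟨F, {}, hadd, hlin, ⟨θ⟩⟩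

end Linear

end Retracts

section Characters

/-- The `k`-valued characters of `G` separate the points of `G`; for finite `G` this is equivalent
to `SplitsOver k G`. -/
class CharactersSeparatePoints (k : Type*) [Field k] (G : Type*) [Group G] : Prop where
  exists_ne_one {g : G} (hg : g ≠ 1) : ∃ χ : G →* kˣ, χ g ≠ 1

open CharactersSeparatePoints (exists_ne_one)

variable {k : Type*} [Field k] {G : Type*} [Group G]

theorem SplitsOver.charactersSeparatePoints (h : SplitsOver k G) :
    CharactersSeparatePoints k G where
  exists_ne_one {g} hg := by
    obtain ⟨n, ⟨e⟩⟩ := h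
    let character (i : Fin n) : G →* kˣ :=
      MonoidHom.toHomUnits (((Pi.evalMonoidHom (fun _ => k) i).comp
        (e : MonoidAlgebra k G →* (Fin n → k))).comp (MonoidAlgebra.of k G))
    by_contra! hχ
    refine hg (MonoidAlgebra.of_injective (R := k) (e.injective (funext fun i => ?_)))
    rw [map_one]
    exact congrArg Units.val ((hχ (character i)).trans (map_one (character i)).symm)

theorem sum_character [Fintype G] {χ : G →* kˣ} (hχ : χ ≠ 1) : ∑ g, (χ g : k) = 0 :=
  sum_hom_units_eq_zero ((Units.coeHom k).comp χ) fun h =>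
    hχ (MonoidHom.ext fun g => Units.ext (DFunLike.congr_fun h g))

theorem sum_characters_apply [CharactersSeparatePoints k G] [Fintype (G →* kˣ)] {g : G}
    (hg : g ≠ 1) : ∑ χ : G →* kˣ, (χ g : k) = 0 := by
  obtain ⟨χ, hχ⟩ := exists_ne_one (k := k) hg
  exact sum_hom_units_eq_zero ((Units.coeHom k).comp (MonoidHom.eval g)) fun h =>
    hχ (Units.ext (DFunLike.congr_fun h χ))

variable (k G) [Finite G]

theorem card_characters_le : Nat.card (G →* kˣ) ≤ Nat.card G := by
  have := Fintype.ofFinite G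
  have := Fintype.ofFinite (G →* kˣ)
  have h : LinearIndependent k fun (χ : G →* kˣ) (g : G) => (χ g : k) :=
    (linearIndependent_monoidHom G k).comp (fun χ : G →* kˣ => (Units.coeHom k).comp χ)
      fun χ ψ h => MonoidHom.ext fun g => Units.ext (DFunLike.congr_fun h g)
  simpa [Nat.card_eq_fintype_card] using h.fintype_card_le_finrank

theorem card_characters [CharactersSeparatePoints k G] : Nat.card (G →* kˣ) = Nat.card G := by
  refine (card_characters_le k G).antisymm ?_
  refine (Nat.card_le_card_of_injective (MonoidHom.eval : G →* (G →* kˣ) →* kˣ)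
    ((injective_iff_map_eq_one _).2 fun g hg => ?_)).trans (card_characters_le k (G →* kˣ))
  by_contra h
  obtain ⟨χ, hχ⟩ := exists_ne_one (k := k) h
  exact hχ (DFunLike.congr_fun hg χ)

/-- If `p` divided the order of `G`, characters in characteristic `p` could not separate an element
of order `p` from `1`. -/
theorem natCast_card_ne_zero [CharactersSeparatePoints k G] : (Nat.card G : k) ≠ 0 := fun hG => by
  obtain ⟨p, hp, hchar⟩ := (CharP.exists' k).resolve_left fun h =>
    Nat.card_pos.ne' (Nat.cast_injective (hG.trans Nat.cast_zero.symm))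
  obtain ⟨g, hg⟩ := exists_prime_orderOf_dvd_card' p ((CharP.cast_eq_zero_iff k p _).1 hG)
  obtain ⟨χ, hχ⟩ := exists_ne_one (k := k) (g := g) fun h => by simp [h, hp.out.ne_one.symm] at hg
  refine hχ (Units.ext (frobenius_inj k p ?_))
  simp [frobenius_def, ← Units.val_pow_eq_pow_val, ← map_pow, ← hg, pow_orderOf_eq_one]

end Characters

section Induction

theorem preservesBiproduct_of_additive {C D : Type*} [Category* C] [Category* D] [Preadditive C]
    [Preadditive D] {J : Type*} [Finite J] (f : J → C) (F : C ⥤ D) [F.Additive] :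
    PreservesBiproduct f F where
  preserves {b} hb := by
    have := Fintype.ofFinite J
    refine ⟨isBilimitOfTotal _ ?_⟩
    calc ∑ j, F.map (b.π j) ≫ F.map (b.ι j) = F.map (∑ j, b.π j ≫ b.ι j) := by simp
      _ = 𝟙 (F.obj b.pt) := by rw [IsBilimit.total hb, F.map_id]

attribute [local instance] preservesBiproduct_of_additive

variable {k : Type*} [Field k] {G : Type*} [Group G]
  {C : Type*} [Category* C] [Preadditive C] [CategoryTheory.Linear k C] (A : LinearAction k G C)

/-- The category of objects of `C` equipped with an equivariant structure, with all morphisms of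
`C` between the underlying objects as morphisms. -/
abbrev EquivObj.Underlying := InducedCategory C (EquivObj.X (A := A))

/-- The fully faithful functor from `EquivObj.Underlying A` to `C`. -/
abbrev EquivObj.forget : EquivObj.Underlying A ⥤ C := inducedFunctor EquivObj.X

variable [Finite G] [HasFiniteBiproducts C]

/-- The isomorphism `⨁ F_g X ≅ F_h (⨁ F_g X)` permuting the summands through `ε_{h,g}`. -/
noncomputable def inductionIso (X : C) (h : G) :
    (⨁ fun g => (A.F g).obj X) ≅ (A.F h).obj (⨁ fun g => (A.F g).obj X) :=
  (biproduct.whiskerEquiv (f := (A.F h).obj ∘ fun g => (A.F g).obj X) (Equiv.mulLeft h)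
    fun g => ((A.ε h g).app X).symm).symm ≪≫ ((A.F h).mapBiproduct _).symm

theorem ι_inductionIso_hom (X : C) (h g : G) :
    biproduct.ι (fun g => (A.F g).obj X) (h * g) ≫ (inductionIso A X h).hom =
      (A.ε h g).inv.app X ≫ (A.F h).map (biproduct.ι (fun g => (A.F g).obj X) g) := by
  have hι : biproduct.ι ((A.F h).obj ∘ fun g => (A.F g).obj X) g ≫
      ((A.F h).mapBiproduct _).inv = (A.F h).map (biproduct.ι (fun g => (A.F g).obj X) g) := by
    rw [Functor.mapBiproduct_inv, biproduct.ι_desc]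
  rw [← hι, ← Iso.app_inv, Iso.eq_inv_comp, ← Category.assoc, inductionIso, Iso.trans_hom,
    Iso.symm_hom, Iso.symm_hom, ← Category.assoc, Iso.cancel_iso_inv_right, Iso.comp_inv_eq]
  simp [biproduct.whiskerEquiv]

/-- The object `⨁ F_g X` induced from `X`, right (and left) adjoint to forgetting the equivariant
structure. -/
noncomputable def induction (X : C) : EquivObj A where
  X := ⨁ fun g => (A.F g).obj X
  α := inductionIso A X
  rel g h := by
    refine biproduct.hom_ext' _ _ fun j => ?_
    obtain ⟨l, rfl⟩ := (Group.mulLeft_bijective (g * h)).surjective j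
    have hε := (A.ε g h).hom.naturality (biproduct.ι (fun g => (A.F g).obj X) l)
    have hcocycle := A.cocycle g h l X
    dsimp only [Functor.comp_obj, Functor.comp_map] at hε hcocycle ⊢
    rw [ι_inductionIso_hom, ← biproduct.eqToHom_comp_ι _ (mul_assoc g h l), Category.assoc,
      reassoc_of% (ι_inductionIso_hom A X g (h * l)), ← Functor.map_comp_assoc, ι_inductionIso_hom,
      Functor.map_comp_assoc, hε]
    rw [← cancel_epi ((A.ε (g * h) l).hom.app X), ← cancel_epi ((A.ε g h).hom.app ((A.F l).obj X)),
      Iso.hom_inv_id_app_assoc, reassoc_of% hcocycle]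
    simp [← Functor.map_comp_assoc]

instance isRetractDense_forget : IsRetractDense (EquivObj.forget A) where
  exists_retract X := by
    let i : (A.F 1).obj X ≅ X :=
      (A.F 1).preimageIso ((A.ε 1 1).app X ≪≫ eqToIso (by rw [mul_one]))
    exact ⟨induction A X, ⟨(Retract.ofIso i.symm).trans
      { i := biproduct.ι (fun g => (A.F g).obj X) 1
        r := biproduct.π (fun g => (A.F g).obj X) 1
        retract := biproduct.ι_π_self _ _ }⟩⟩

end Induction

section WeightProj

variable {k : Type*} [Field k] {G : Type*} [Group G] [Finite G]
  {V : Type*} [AddCommGroup V] [Module k V] (ρ : Representation k G V)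

attribute [local instance] Fintype.ofFinite

/-- For `|G|` invertible in `k`, the projection of the representation `V` onto the space of vectors
`v` with `ρ g v = χ(g⁻¹) v` for all `g`. -/
noncomputable def weightProj (χ : G →* kˣ) : V →ₗ[k] V :=
  (Nat.card G : k)⁻¹ • ∑ g, (χ g : k) • ρ g

theorem weightProj_apply (χ : G →* kˣ) (v : V) :
    weightProj ρ χ v = (Nat.card G : k)⁻¹ • ∑ g, (χ g : k) • ρ g v := by
  simp [weightProj]

theorem apply_weightProj (χ : G →* kˣ) (v : V) (g : G) :
    ρ g (weightProj ρ χ v) = (χ g⁻¹ : k) • weightProj ρ χ v := by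
  have hsum : ρ g (∑ h, (χ h : k) • ρ h v) = (χ g⁻¹ : k) • ∑ h, (χ h : k) • ρ h v := by
    rw [map_sum, ← Equiv.sum_comp (Equiv.mulLeft g) fun h => (χ h : k) • ρ h v, Finset.smul_sum]
    simp [smul_smul]
  rw [weightProj_apply, map_smul, hsum, smul_comm]

variable [CharactersSeparatePoints k G]

theorem weightProj_of_weight {χ : G →* kˣ} {v : V} (hv : ∀ g, ρ g v = (χ g⁻¹ : k) • v)
    (ψ : G →* kˣ) [Decidable (χ = ψ)] : weightProj ρ ψ v = if χ = ψ then v else 0 := by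
  have hsum : weightProj ρ ψ v = ((Nat.card G : k)⁻¹ * ∑ g, ((ψ / χ) g : k)) • v := by
    simp only [weightProj_apply, hv, smul_smul, ← Finset.sum_smul, MonoidHom.div_apply,
      div_eq_mul_inv, map_inv, Units.val_mul]
  split_ifs with h
  · simp [hsum, h, ← Nat.card_eq_fintype_card, natCast_card_ne_zero k G]
  · rw [hsum, sum_character (div_ne_one.2 (Ne.symm h)), mul_zero, zero_smul]

theorem sum_weightProj (v : V) : ∑ χ, weightProj ρ χ v = v := by
  have hsum (g : G) (hg : g ≠ 1) : ∑ χ : G →* kˣ, (χ g : k) • ρ g v = 0 := by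
    rw [← Finset.sum_smul, sum_characters_apply hg, zero_smul]
  simp only [weightProj_apply]
  rw [← Finset.smul_sum, Finset.sum_comm, Fintype.sum_eq_single 1 hsum]
  simp [← Nat.cast_smul_eq_nsmul k, smul_smul, ← Nat.card_eq_fintype_card, card_characters,
    natCast_card_ne_zero k G]

end WeightProj

section Homogeneous

variable {k : Type*} [Field k] {G : Type*} [Group G]
  {C : Type*} [Category* C] [Preadditive C] [CategoryTheory.Linear k C] {A : LinearAction k G C}

namespace EquivObj

/-- The action of `G` on the morphisms in `C` between the objects underlying `P` and `Q`,
`g • f = α_g⁻¹ ∘ F_g(f) ∘ α_g`. -/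
def conj (P Q : EquivObj A) : Representation k G (P.X ⟶ Q.X) :=
  have map_mul (g h : G) (f : P.X ⟶ Q.X) :
      (P.α (g * h)).hom ≫ (A.F (g * h)).map f ≫ (Q.α (g * h)).inv = (P.α g).hom ≫
        (A.F g).map ((P.α h).hom ≫ (A.F h).map f ≫ (Q.α h).inv) ≫ (Q.α g).inv := by
    have hε := (A.ε g h).hom.naturality f
    dsimp only [Functor.comp_map] at hε
    rw [← cancel_mono (Q.α (g * h)).hom]
    simp only [Category.assoc, Iso.inv_hom_id, Category.comp_id]
    rw [P.rel, Q.rel]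
    simp only [Functor.map_comp, Category.assoc, Iso.inv_hom_id_assoc, ← hε]
    rw [Iso.map_inv_hom_id_assoc]
  { toFun g :=
      { toFun f := (P.α g).hom ≫ (A.F g).map f ≫ (Q.α g).inv
        map_add' f f' := by simp
        map_smul' c f := by simp }
    map_one' := LinearMap.ext fun f => by
      have h := map_mul 1 1 f
      rw [mul_one, cancel_epi, cancel_mono] at h
      exact ((A.F 1).map_injective h).symm
    map_mul' g h := LinearMap.ext (map_mul g h) }

variable {P Q : EquivObj A}

theorem conj_apply (g : G) (f : P.X ⟶ Q.X) :
    conj P Q g f = (P.α g).hom ≫ (A.F g).map f ≫ (Q.α g).inv := rfl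

theorem conj_f {χ : G →* kˣ} (a : P ⟶ twistObj A χ Q) (g : G) :
    conj P Q g a.f = (χ g⁻¹ : k) • a.f := by
  have h := a.comm g
  rw [twistObj_α_hom] at h
  rw [conj_apply, ← reassoc_of% h]
  simp

theorem comm_of_conj {χ : G →* kˣ} {f : P.X ⟶ Q.X} {g : G}
    (hf : conj P Q g f = (χ g⁻¹ : k) • f) :
    f ≫ ((twistObj A χ Q).α g).hom = (P.α g).hom ≫ (A.F g).map f := by
  rw [twistObj_α_hom, Linear.comp_smul, ← Linear.smul_comp, ← hf, conj_apply]
  simp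

variable [Finite G] [CharactersSeparatePoints k G]

attribute [local instance] Fintype.ofFinite

variable (P Q) in
/-- Since `χ⁻¹` is the weight of `G` on morphisms `P ⟶ F_χ Q`, the weight decomposition of the
morphisms in `C` expresses them through the morphisms of `C^G`. -/
noncomputable def decompose :
    (P.X ⟶ Q.X) ≃ₗ[k] ((χ : G →* kˣ) → (P ⟶ twistObj A χ Q)) where
  toFun f χ := ⟨weightProj (conj P Q) χ f, fun g => comm_of_conj (apply_weightProj _ χ f g)⟩
  map_add' f f' := funext fun χ => hom_ext (map_add _ f f')
  map_smul' c f := funext fun χ => hom_ext (map_smul _ c f)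
  invFun a := ∑ χ, (a χ).f
  left_inv f := sum_weightProj _ f
  right_inv a := funext fun ψ => hom_ext (by
    classical
    simp [weightProj_of_weight _ (conj_f (a _))])

theorem decompose_symm_apply (a : (χ : G →* kˣ) → (P ⟶ twistObj A χ Q)) :
    (decompose P Q).symm a = ∑ χ, (a χ).f := rfl

theorem decompose_symm_single [DecidableEq (G →* kˣ)] {χ : G →* kˣ} (a : P ⟶ twistObj A χ Q) :
    (decompose P Q).symm (Pi.single χ a) = a.f := by
  rw [decompose_symm_apply, Fintype.sum_eq_single χ fun ψ h => by rw [Pi.single_eq_of_ne h]; rfl,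
    Pi.single_eq_same]

@[elab_as_elim]
theorem homogeneous_induction {p : (P.X ⟶ Q.X) → Prop}
    (add : ∀ f f', p f → p f' → p (f + f'))
    (homogeneous : ∀ (χ : G →* kˣ) (a : P ⟶ twistObj A χ Q), p a.f) (f : P.X ⟶ Q.X) : p f := by
  rw [← (decompose P Q).symm_apply_apply f]
  exact Finset.sum_induction _ p add (homogeneous 1 0) fun χ _ => homogeneous χ _

end EquivObj

end Homogeneous

section Injectivity

variable {k : Type*} [Field k] {G : Type*} [Group G]
  {C : Type*} [Category* C] [Preadditive C] [CategoryTheory.Linear k C] {A : LinearAction k G C}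

variable (A) in
/-- The functor from `C^G` to `EquivObj.Underlying A` that is the identity on objects. -/
abbrev EquivObj.toUnderlying : EquivObj A ⥤ EquivObj.Underlying A where
  obj P := P
  map a := ⟨a.f⟩

namespace EquivAut

variable {E E' : EquivAut A}

theorem app_twist_f {φ : E.equivariantization.F ≅ E'.equivariantization.F}
    (hφ : ∀ (χ : G →* kˣ) (P : EquivObj A),
      (E.equivariantization.δ χ).hom.app P ≫ (twist A χ).map (φ.hom.app P) =
        φ.hom.app ((twist A χ).obj P) ≫ (E'.equivariantization.δ χ).hom.app P)
    (χ : G →* kˣ) (P : EquivObj A) : (φ.hom.app (twistObj A χ P)).f = (φ.hom.app P).f := by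
  have h := congrArg EquivObj.Hom.f (hφ χ P)
  rw [EquivObj.comp_f, EquivObj.comp_f, equivariantization_δ_f, equivariantization_δ_f] at h
  exact (Category.comp_id _).symm.trans (h.symm.trans (Category.id_comp _))

variable [Finite G] [CharactersSeparatePoints k G] [HasFiniteBiproducts C]

theorem isomorphic_of_equivariantization
    (h : Isomorphic E.equivariantization E'.equivariantization) : Isomorphic E E' := by
  obtain ⟨φ, hφ⟩ := h
  let η : EquivObj.forget A ⋙ E.F ≅ EquivObj.forget A ⋙ E'.F := NatIso.ofComponents
    (fun P => (EquivObj.forget A).mapIso ((EquivObj.toUnderlying A).mapIso (φ.app P)))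
    fun {P Q} f => by
      change E.F.map f.hom ≫ (φ.hom.app Q).f = (φ.hom.app P).f ≫ E'.F.map f.hom
      induction f.hom using EquivObj.homogeneous_induction with
      | add f f' hf hf' => simp [hf, hf']
      | homogeneous χ a =>
        rw [← app_twist_f hφ χ Q]
        exact congrArg EquivObj.Hom.f (φ.hom.naturality a)
  obtain ⟨t, ht⟩ := exists_natIso_of_isRetractDense (EquivObj.forget A) η
  have t_app (P : EquivObj A) : t.hom.app P.X = (φ.hom.app P).f := ht P
  refine ⟨t, fun g X => NatTrans.congr_app (natTrans_ext_of_isRetractDense (EquivObj.forget A)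
    (σ := (E.δ g).hom ≫ Functor.whiskerRight t.hom (A.F g))
    (τ := Functor.whiskerLeft (A.F g) t.hom ≫ (E'.δ g).hom) fun P => ?_) X⟩
  have φ_comm := (φ.hom.app P).comm g
  have t_naturality := t.hom.naturality (P.α g).hom
  simp only [t_app] at t_naturality
  change (E.δ g).hom.app P.X ≫ (A.F g).map (t.hom.app P.X) =
      t.hom.app ((A.F g).obj P.X) ≫ (E'.δ g).hom.app P.X
  rw [← cancel_epi (E.F.map (P.α g).hom), reassoc_of% t_naturality, t_app]
  simpa using φ_comm.symm

end EquivAut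

end Injectivity

section Extension

variable {k : Type*} [Field k] {G : Type*} [Group G]
  {C : Type*} [Category* C] [Preadditive C] [CategoryTheory.Linear k C] {A : LinearAction k G C}
  {P Q R : EquivObj A} {χ ψ : G →* kˣ}

/-- The composite of a morphism of degree `χ` with one of degree `ψ`, where a morphism `P ⟶ F_χ Q`
is thought of as a morphism of degree `χ` from `P` to `Q`. -/
def degreeComp (a : P ⟶ twistObj A χ Q) (b : Q ⟶ twistObj A ψ R) : P ⟶ twistObj A (χ * ψ) R :=
  a ≫ (twist A χ).map b ≫ (twistCompIso A χ ψ R).hom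

theorem degreeComp_f (a : P ⟶ twistObj A χ Q) (b : Q ⟶ twistObj A ψ R) :
    (degreeComp a b).f = a.f ≫ b.f :=
  congrArg (a.f ≫ ·) (Category.comp_id b.f)

namespace EquivAut

variable (E : EquivAut (dualAction A))

/-- The action of a `Ĝ`-equivariant autoequivalence of `C^G` on the morphisms of degree `χ`. -/
noncomputable def degreeEquiv :
    (P ⟶ twistObj A χ Q) ≃ₗ[k] (E.F.obj P ⟶ twistObj A χ (E.F.obj Q)) :=
  (LinearEquiv.ofBijective (E.F.mapLinearMap k) ⟨E.F.map_injective, E.F.map_surjective⟩).trans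
    (Linear.homCongr k (Iso.refl _) ((E.δ χ).app Q))

theorem degreeEquiv_apply (a : P ⟶ twistObj A χ Q) :
    E.degreeEquiv a = E.F.map a ≫ (E.δ χ).hom.app Q :=
  congrArg (· ≫ (E.δ χ).hom.app Q) (Category.id_comp (E.F.map a))

theorem degreeEquiv_degreeComp (a : P ⟶ twistObj A χ Q) (b : Q ⟶ twistObj A ψ R) :
    E.degreeEquiv (degreeComp a b) = degreeComp (E.degreeEquiv a) (E.degreeEquiv b) := by
  have hcompat := E.compat χ ψ R
  have hδ := (E.δ χ).hom.naturality b
  change E.F.map (twistCompIso A χ ψ R).hom ≫ _ = _ at hcompat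
  rw [Functor.comp_map, Functor.comp_map] at hδ
  rw [degreeEquiv_apply, degreeEquiv_apply, degreeEquiv_apply, degreeComp, degreeComp,
    E.F.map_comp, E.F.map_comp, Functor.map_comp (twist A χ), Category.assoc, Category.assoc,
    Category.assoc, Category.assoc, hcompat, reassoc_of% hδ]
  rfl

variable [Finite G] [CharactersSeparatePoints k G]

variable (P Q) in
/-- A `Ĝ`-equivariant autoequivalence of `C^G` acts on all morphisms of `C` between objects with an
equivariant structure, because these are sums of homogeneous ones. -/
noncomputable def extendEquiv : (P.X ⟶ Q.X) ≃ₗ[k] ((E.F.obj P).X ⟶ (E.F.obj Q).X) :=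
  EquivObj.decompose P Q ≪≫ₗ LinearEquiv.piCongrRight (fun χ => E.degreeEquiv (χ := χ)) ≪≫ₗ
    (EquivObj.decompose _ _).symm

theorem extendEquiv_homogeneous (a : P ⟶ twistObj A χ Q) :
    E.extendEquiv P Q a.f = (E.degreeEquiv a).f := by
  classical
  rw [← EquivObj.decompose_symm_single a, ← EquivObj.decompose_symm_single (E.degreeEquiv a)]
  simp only [extendEquiv, LinearEquiv.trans_apply, LinearEquiv.apply_symm_apply]
  congr 1
  ext1 ψ
  exact Pi.apply_single (fun χ => E.degreeEquiv (χ := χ)) (fun _ => map_zero _) χ a ψ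

theorem extendEquiv_comp (f : P.X ⟶ Q.X) (g : Q.X ⟶ R.X) :
    E.extendEquiv P R (f ≫ g) = E.extendEquiv P Q f ≫ E.extendEquiv Q R g := by
  induction f using EquivObj.homogeneous_induction with
  | add f f' hf hf' => simp only [Preadditive.add_comp, map_add, hf, hf']
  | homogeneous χ a =>
    induction g using EquivObj.homogeneous_induction with
    | add g g' hg hg' => simp only [Preadditive.comp_add, map_add, hg, hg']
    | homogeneous ψ b =>
      rw [← degreeComp_f, extendEquiv_homogeneous, extendEquiv_homogeneous,
        extendEquiv_homogeneous, degreeEquiv_degreeComp, degreeComp_f]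

theorem extendEquiv_id (P : EquivObj A) : E.extendEquiv P P (𝟙 P.X) = 𝟙 (E.F.obj P).X := by
  obtain ⟨f, hf⟩ := (E.extendEquiv P P).surjective (𝟙 (E.F.obj P).X)
  rw [← hf, ← Category.comp_id f, extendEquiv_comp, hf, Category.id_comp]

theorem extendEquiv_f (a : P ⟶ Q) : E.extendEquiv P Q a.f = (E.F.map a).f := by
  let u : Q ⟶ twistObj A 1 Q := eqToHom (twist_obj_one A Q).symm
  have u_f : u.f = 𝟙 Q.X := eqToHom_f A (twist_obj_one A Q).symm
  have h := E.extendEquiv_homogeneous (a ≫ u)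
  rw [degreeEquiv_apply, Functor.map_comp, Category.assoc, ← degreeEquiv_apply, EquivObj.comp_f,
    EquivObj.comp_f, ← extendEquiv_homogeneous, u_f, extendEquiv_id] at h
  exact ((congrArg _ (Category.comp_id _)).symm.trans h).trans (Category.comp_id _)

theorem extendEquiv_conj (g : G) (f : P.X ⟶ Q.X) :
    E.extendEquiv P Q (EquivObj.conj P Q g f) = EquivObj.conj _ _ g (E.extendEquiv P Q f) := by
  induction f using EquivObj.homogeneous_induction with
  | add f f' hf hf' => simp only [map_add, hf, hf']
  | homogeneous χ a =>
    rw [EquivObj.conj_f, map_smul, extendEquiv_homogeneous, EquivObj.conj_f]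

/-- The extension of a `Ĝ`-equivariant autoequivalence of `C^G` to the objects of `C` with an
equivariant structure, with all morphisms of `C` between them. -/
noncomputable def extension : EquivObj.Underlying A ⥤ EquivObj.Underlying A where
  obj P := E.F.obj P
  map {P Q} f := ⟨E.extendEquiv P Q f.hom⟩
  map_id P := InducedCategory.hom_ext (E.extendEquiv_id P)
  map_comp f g := InducedCategory.hom_ext (E.extendEquiv_comp f.hom g.hom)

instance : E.extension.Additive where
  map_add := InducedCategory.hom_ext (map_add (E.extendEquiv _ _) _ _)

instance : E.extension.Linear k where
  map_smul _ _ := InducedCategory.hom_ext (map_smul (E.extendEquiv _ _) _ _)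

instance : E.extension.IsEquivalence where
  faithful.map_injective h := InducedCategory.hom_ext
    ((E.extendEquiv _ _).injective (congrArg InducedCategory.Hom.hom h))
  full.map_surjective f :=
    ⟨⟨(E.extendEquiv _ _).symm f.hom⟩,
      InducedCategory.hom_ext ((E.extendEquiv _ _).apply_symm_apply f.hom)⟩
  essSurj.mem_essImage Q :=
    ⟨E.F.objPreimage Q, ⟨(EquivObj.toUnderlying A).mapIso (E.F.objObjPreimageIso Q)⟩⟩

end EquivAut

end Extension

section Descent

variable {k : Type*} [Field k] {G : Type*} [Group G]
  {C : Type*} [Category* C] [Preadditive C] [CategoryTheory.Linear k C] {A : LinearAction k G C}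
  {F : C ⥤ C} {L : EquivObj.Underlying A ⥤ EquivObj.Underlying A}
  (θ : EquivObj.forget A ⋙ F ≅ L ⋙ EquivObj.forget A)

/-- If `F` extends `L` to `C`, the isomorphism `F F_g ≅ F_g F` at the object underlying `P` through
which `F` carries the equivariant structure of `P` to that of `L P`. -/
def descentIso (g : G) (P : EquivObj A) :
    F.obj ((A.F g).obj P.X) ≅ (A.F g).obj (F.obj P.X) :=
  F.mapIso (P.α g).symm ≪≫ θ.app P ≪≫ (L.obj P).α g ≪≫ (A.F g).mapIso (θ.app P).symm

theorem map_α_descentIso (g : G) (P : EquivObj A) :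
    F.map (P.α g).hom ≫ (descentIso θ g P).hom ≫ (A.F g).map (θ.hom.app P) =
      θ.hom.app P ≫ ((L.obj P).α g).hom := by
  simp only [descentIso, Iso.trans_hom, Functor.mapIso_hom, Iso.symm_hom, Iso.app_hom,
    Category.assoc]
  rw [Iso.map_hom_inv_id_assoc, ← Functor.map_comp, ← Iso.app_hom, Iso.inv_hom_id,
    (A.F g).map_id, Category.comp_id]

theorem descentIso_naturality
    (hL : ∀ (g : G) (P Q : EquivObj A) (f : P.X ⟶ Q.X),
      (L.map (X := P) (Y := Q) ⟨EquivObj.conj P Q g f⟩).hom =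
        EquivObj.conj _ _ g (L.map (X := P) (Y := Q) ⟨f⟩).hom)
    (g : G) {P Q : EquivObj A} (f : P.X ⟶ Q.X) :
    F.map ((A.F g).map f) ≫ (descentIso θ g Q).hom =
      (descentIso θ g P).hom ≫ (A.F g).map (F.map f) := by
  have hθ (f : P.X ⟶ Q.X) : F.map f ≫ θ.hom.app Q =
      θ.hom.app P ≫ (L.map (X := P) (Y := Q) ⟨f⟩).hom :=
    θ.hom.naturality (X := P) (Y := Q) ⟨f⟩
  have conj_comp {P Q : EquivObj A} (f : P.X ⟶ Q.X) :
      EquivObj.conj P Q g f ≫ (Q.α g).hom = (P.α g).hom ≫ (A.F g).map f := by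
    simp [EquivObj.conj_apply]
  rw [← cancel_epi (F.map (P.α g).hom), ← cancel_mono ((A.F g).map (θ.hom.app Q))]
  simp only [Category.assoc]
  calc F.map (P.α g).hom ≫ F.map ((A.F g).map f) ≫ (descentIso θ g Q).hom ≫
        (A.F g).map (θ.hom.app Q)
      = F.map (EquivObj.conj P Q g f) ≫ θ.hom.app Q ≫ ((L.obj Q).α g).hom := by
        rw [← map_α_descentIso, ← F.map_comp_assoc, ← F.map_comp_assoc, conj_comp]
    _ = (θ.hom.app P ≫ ((L.obj P).α g).hom) ≫
        (A.F g).map (L.map (X := P) (Y := Q) ⟨f⟩).hom := by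
        rw [reassoc_of% (hθ (EquivObj.conj P Q g f)), hL, conj_comp, Category.assoc]
    _ = F.map (P.α g).hom ≫ (descentIso θ g P).hom ≫ (A.F g).map (F.map f) ≫
        (A.F g).map (θ.hom.app Q) := by
        rw [← map_α_descentIso, ← Functor.map_comp, hθ, Functor.map_comp]
        simp only [Category.assoc]

/-- `θ` identifies `L P` with the equivariant object to which `(F, δ)` sends `P`. -/
def IsStructureCompatible (δ : ∀ g, A.F g ⋙ F ≅ F ⋙ A.F g) : Prop :=
  ∀ (g : G) (P : EquivObj A), F.map (P.α g).hom ≫ (δ g).hom.app P.X ≫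
    (A.F g).map (θ.hom.app P) = θ.hom.app P ≫ ((L.obj P).α g).hom

variable {θ} {δ : ∀ g, A.F g ⋙ F ≅ F ⋙ A.F g}

theorem descent_compat_app (hδ : IsStructureCompatible θ δ) (g h : G) (P : EquivObj A) :
    F.map ((A.ε g h).hom.app P.X) ≫ (δ (g * h)).hom.app P.X =
      (δ g).hom.app ((A.F h).obj P.X) ≫ (A.F g).map ((δ h).hom.app P.X) ≫
        (A.ε g h).hom.app (F.obj P.X) := by
  have δ_naturality := (δ g).hom.naturality (P.α h).hom
  have ε_naturality : (A.F g).map ((A.F h).map (θ.hom.app P)) ≫ (A.ε g h).hom.app (L.obj P).X =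
      (A.ε g h).hom.app (F.obj P.X) ≫ (A.F (g * h)).map (θ.hom.app P) :=
    (A.ε g h).hom.naturality (θ.hom.app P)
  dsimp only [Functor.comp_obj, Functor.comp_map] at δ_naturality
  rw [← cancel_epi (F.map ((A.F g).map (P.α h).hom)), ← cancel_epi (F.map (P.α g).hom),
    ← cancel_mono ((A.F (g * h)).map (θ.hom.app P))]
  simp only [Category.assoc]
  calc F.map (P.α g).hom ≫ F.map ((A.F g).map (P.α h).hom) ≫ F.map ((A.ε g h).hom.app P.X) ≫
        (δ (g * h)).hom.app P.X ≫ (A.F (g * h)).map (θ.hom.app P)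
      = F.map (P.α (g * h)).hom ≫ (δ (g * h)).hom.app P.X ≫
        (A.F (g * h)).map (θ.hom.app P) := by
        rw [P.rel]
        simp only [Functor.map_comp, Category.assoc]
    _ = (θ.hom.app P ≫ ((L.obj P).α g).hom) ≫ (A.F g).map ((L.obj P).α h).hom ≫
        (A.ε g h).hom.app (L.obj P).X := by
        rw [hδ (g * h) P, (L.obj P).rel, Category.assoc]
    _ = F.map (P.α g).hom ≫ (δ g).hom.app P.X ≫ (A.F g).map (F.map (P.α h).hom ≫
        (δ h).hom.app P.X ≫ (A.F h).map (θ.hom.app P)) ≫ (A.ε g h).hom.app (L.obj P).X := by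
        rw [hδ h P, ← hδ g P, Functor.map_comp]
        simp only [Category.assoc]
    _ = _ := by
        simp only [Functor.map_comp, Category.assoc]
        rw [ε_naturality, reassoc_of% δ_naturality]

theorem descent_compat [Finite G] [HasFiniteBiproducts C] (hδ : IsStructureCompatible θ δ)
    (g h : G) (X : C) :
    F.map ((A.ε g h).hom.app X) ≫ (δ (g * h)).hom.app X =
      (δ g).hom.app ((A.F h).obj X) ≫ (A.F g).map ((δ h).hom.app X) ≫
        (A.ε g h).hom.app (F.obj X) := by
  let σ : (A.F h ⋙ A.F g) ⋙ F ⟶ F ⋙ A.F (g * h) :=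
    Functor.whiskerRight (A.ε g h).hom F ≫ (δ (g * h)).hom
  let τ : (A.F h ⋙ A.F g) ⋙ F ⟶ F ⋙ A.F (g * h) :=
    (Functor.associator _ _ _).hom ≫ Functor.whiskerLeft (A.F h) (δ g).hom ≫
      (Functor.associator _ _ _).inv ≫ Functor.whiskerRight (δ h).hom (A.F g) ≫
        (Functor.associator _ _ _).hom ≫ Functor.whiskerLeft F (A.ε g h).hom
  have σ_eq_τ : σ = τ := natTrans_ext_of_isRetractDense (EquivObj.forget A) fun P => by
    simpa [σ, τ] using descent_compat_app hδ g h P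
  simpa [σ, τ] using NatTrans.congr_app σ_eq_τ X

end Descent

section Surjectivity

variable {k : Type*} [Field k] {G : Type*} [Group G] [Finite G] [CharactersSeparatePoints k G]
  {C : Type*} [Category* C] [Preadditive C] [CategoryTheory.Linear k C] [HasFiniteBiproducts C]
  {A : LinearAction k G C}

namespace EquivAut

variable (E : EquivAut (dualAction A))

theorem exists_isStructureCompatible {F : C ⥤ C}
    (θ : EquivObj.forget A ⋙ F ≅ E.extension ⋙ EquivObj.forget A) :
    ∃ δ : ∀ g, A.F g ⋙ F ≅ F ⋙ A.F g, IsStructureCompatible θ δ := by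
  choose δ hδ using fun g => exists_natIso_of_isRetractDense (EquivObj.forget A)
    (F := A.F g ⋙ F) (F' := F ⋙ A.F g) (NatIso.ofComponents (descentIso θ g) fun f =>
      descentIso_naturality θ (fun g _ _ => E.extendEquiv_conj g) g f.hom)
  refine ⟨δ, fun g P => ?_⟩
  rw [show (δ g).hom.app P.X = _ from hδ g P]
  exact map_α_descentIso θ g P

theorem exists_equivariantization_isomorphic [IsIdempotentComplete C] :
    ∃ E' : EquivAut A, Isomorphic E'.equivariantization E := by
  obtain ⟨F, hF, hadd, hlin, ⟨θ⟩⟩ :=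
    exists_extension (k := k) (EquivObj.forget A) (EquivObj.forget A) E.extension
  obtain ⟨δ, hδ⟩ := E.exists_isStructureCompatible θ
  have hθ {P Q : EquivObj A} (f : P.X ⟶ Q.X) :
      F.map f ≫ θ.hom.app Q = θ.hom.app P ≫ E.extendEquiv P Q f :=
    θ.hom.naturality (X := P) (Y := Q) ⟨f⟩
  let E' : EquivAut A := ⟨F, hF, hadd, hlin, δ, descent_compat hδ⟩
  refine ⟨E', NatIso.ofComponents (fun P => EquivObj.isoMk (θ.app P) fun g => ?_) fun a => ?_,
    fun χ P => ?_⟩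
  · exact (hδ g P).symm.trans (Category.assoc _ _ _).symm
  · ext
    exact (hθ a.f).trans (congrArg _ (E.extendEquiv_f a))
  · have hχ : E.extendEquiv (twistObj A χ P) P (𝟙 P.X) = _ :=
      E.extendEquiv_homogeneous (𝟙 (twistObj A χ P))
    rw [degreeEquiv_apply, E.F.map_id, Category.id_comp] at hχ
    ext
    rw [EquivObj.comp_f, EquivObj.comp_f, equivariantization_δ_f]
    change 𝟙 _ ≫ θ.hom.app P = θ.hom.app (twistObj A χ P) ≫ ((E.δ χ).hom.app P).f
    rw [← hχ, ← hθ (P := twistObj A χ P) (Q := P) (𝟙 P.X), F.map_id]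
    rfl

end EquivAut

end Surjectivity

end Equivariantization

theorem theorem5p4 {k : Type w'} [Field k] {G : Type w} [CommGroup G] [Finite G]
    {C : Type u} [Category.{v} C] [Preadditive C] [CategoryTheory.Linear k C]
    [HasFiniteBiproducts C] [IsIdempotentComplete C]
    (hsplit : Equivariantization.SplitsOver k G)
    (A : Equivariantization.LinearAction k G C) :
    Function.Bijective (Equivariantization.EquivAut.equivariantizationHom A) ∧
      ∀ E : Equivariantization.EquivAut (Equivariantization.dualAction A),
        ∃ E' : Equivariantization.EquivAut (Equivariantization.dualAction A),
          E'.IsStrict ∧ E.Isomorphic E' := by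
  have := hsplit.charactersSeparatePoints
  have hsurj := Equivariantization.EquivAut.exists_equivariantization_isomorphic (A := A)
  refine ⟨⟨?injective, ?surjective⟩, fun E => ?strict⟩
  case injective =>
    rintro ⟨E⟩ ⟨E'⟩ h
    exact Equivariantization.EquivAut.cls_eq_iff.2
      (Equivariantization.EquivAut.isomorphic_of_equivariantization
        (Equivariantization.EquivAut.cls_eq_iff.1 h))
  case surjective =>
    rintro ⟨E⟩
    obtain ⟨E', h⟩ := hsurj E
    exact ⟨Equivariantization.EquivAut.cls E', Equivariantization.EquivAut.cls_eq_iff.2 h⟩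
  case strict =>
    obtain ⟨E', h⟩ := hsurj E
    exact ⟨E'.equivariantization, fun χ => ⟨E'.lift_twist χ, rfl⟩, h.symm⟩
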